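/- Fix an integer $k\ge 0$ and a subgroup $\Gamma\le S_k$. For $n\ge 0$ let $G_n=\Gamma^n\rtimes S_n$ be the wreath product, where $S_n$ permutes the coordinates of $\Gamma^n$, acting on $kn$ points arranged in $n$ blocks of size $k$: the elements of $\Gamma^n$ permute the points inside the blocks, one coordinate for each block, and $S_n$ permutes the blocks. For $\sigma\in G_n$ and $i\ge 1$ let $a_i(\sigma)$ be the number of $i$-cycles of $\sigma$ as a permutation of these $kn$ points (fixed points are $1$-cycles; $a_i(\sigma)=0$ for $i>kn$). For a partition $\lambda\vdash k$ let $a_j(\lambda)$ be the number of parts of $\lambda$ equal to $j$, and let $P_\Gamma(\lambda)$ be the probability that a uniformly chosen element of $\Gamma$ has cycle type $\lambda$. Let $Z_{l\lambda}$, for $l\ge 1$ and $\lambda\vdash k$, be independent random variables with $$Z_{l\lambda}\sim\mathrm{Poi}\left(\frac{P_\Gamma(\lambda)}{l}\right),$$ and for $i\ge 1$ put $$A_i=\sum_{\lambda\vdash k}\ \sum_{\substack{j,l\ge 1\\ jl=i}}a_j(\lambda)\,Z_{l\lambda}.$$ Let $\sigma_n$ be chosen uniformly from $G_n$. Then, as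 $n\to\infty$, the joint law of $(a_i(\sigma_n))_{i\ge 1}$ converges weakly to the joint law of $(A_i)_{i\ge 1}$, as probability measures on $\{0,1,2,\dots\}^{\{1,2,\dots\}}$ with the product topology. -/

import Mathlib

open MeasureTheory ProbabilityTheory Filter
open scoped NNReal

/-- The wreath product `Γⁿ ⋊ Sₙ` of a permutation group `Γ ≤ S_k` by the symmetric group `Sₙ`,
which acts on `Γⁿ` by permuting the coordinates: `(h • γ) i = γ (h⁻¹ i)`. -/
abbrev WreathProduct {k : ℕ} (Γ : Subgroup (Equiv.Perm (Fin k))) (n : ℕ) : Type :=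
  (Fin n → Γ) ⋊[mulAutArrow (G := Equiv.Perm (Fin n)) (A := Fin n) (M := Γ)] Equiv.Perm (Fin n)

namespace WreathProduct

variable {k : ℕ} {Γ : Subgroup (Equiv.Perm (Fin k))} {n : ℕ}

instance : Finite (WreathProduct Γ n) :=
  Finite.of_equiv _ SemidirectProduct.equivProd.symm

/-- All subsets of the finite group `Γⁿ ⋊ Sₙ` are events. -/
instance : MeasurableSpace (WreathProduct Γ n) := ⊤

instance : DiscreteMeasurableSpace (WreathProduct Γ n) := ⟨fun _ => trivial⟩

/-- The action of `Γⁿ ⋊ Sₙ` on `kn` points, arranged in `n` blocks of size `k`: the point `(b, x)`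
is the point at position `x` of block `b`. The subgroup `Γⁿ` permutes the points inside the
blocks, and `Sₙ` permutes the blocks. -/
def toPerm : WreathProduct Γ n →* Equiv.Perm (Fin n × Fin k) where
  toFun g :=
    { toFun := fun p => (g.right p.1, (g.left (g.right p.1) : Equiv.Perm (Fin k)) p.2)
      invFun := fun p => (g.right⁻¹ p.1, (g.left p.1 : Equiv.Perm (Fin k))⁻¹ p.2)
      left_inv := fun p => by simp
      right_inv := fun p => by simp }
  map_one' := by ext p <;> simp
  map_mul' g g' := by
    have h (b : Fin n) : (mulAutArrow g.right g'.left) b = g'.left (g.right⁻¹ b) := rfl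
    ext p <;> simp [h, -mulAutArrow_apply_apply]

end WreathProduct

/-- `a_i(σ)`: the number of cycles of length `i` of the permutation `σ`; fixed points are the cycles
of length `1`. -/
def cycleCount {α : Type*} [Fintype α] [DecidableEq α] (σ : Equiv.Perm α) (i : ℕ) : ℕ :=
  σ.partition.parts.count i

/-- `P_Γ(lam)`: the probability that a uniformly chosen element of `Γ ≤ S_k` has cycle type the
partition `lam` of `k` (fixed points being counted as parts equal to `1`). -/
noncomputable def cycleTypeProb {k : ℕ} (Γ : Subgroup (Equiv.Perm (Fin k))) (lam : k.Partition) :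
    ℝ≥0 :=
  (Nat.card {γ : Γ // (γ : Equiv.Perm (Fin k)).partition.parts = lam.parts} : ℝ≥0) / Nat.card Γ

/-- The sum `∑ a_j(lam) z_{l, lam}` over all partitions `lam` of `k` and all pairs `(j, l)` of
positive integers with `j l = i`, where `a_j(lam)` is the number of parts of `lam` equal to `j`. -/
def cycleSum {k : ℕ} (z : ℕ+ → k.Partition → ℕ) (i : ℕ+) : ℕ :=
  ∑ lam : k.Partition,
    ∑ p ∈ (Finset.Icc (1 : ℕ+) i ×ˢ Finset.Icc (1 : ℕ+) i).filter (fun p => p.1 * p.2 = i),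
      lam.parts.count (p.1 : ℕ) * z p.2 lam

/-!
Let `xᵢ = 2 ^ (-mᵢ)` with only finitely many `mᵢ ≠ 0`. Through `a ↦ 2 ^ (-a)` a family of natural
numbers becomes a point of a cube, on which the monomials span a separating algebra of continuous
functions; the cube is compact, so it suffices that `𝔼 ∏ xᵢ ^ aᵢ(σₙ)` tends to `𝔼 ∏ xᵢ ^ Aᵢ` for
all such `x` (`tendsto_of_forall_tendsto_pgf`).

Consider `(γ, h) ∈ Γⁿ ⋊ Sₙ`. A cycle of `h` through `l` blocks returns to a block after `l` steps
and has then acted on it by some element of `Γ`, the cycle product; each `j`-cycle of the cycle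
product gives a cycle of length `l j` (`WreathProduct.partition_parts_toPerm`). For fixed `h` and
uniform `γ`, the cycle products of the different cycles of `h` are independent and uniform on `Γ`
(`WreathProduct.sum_prod_cycleProduct`), because a cycle product can be exchanged for a single
coordinate of `γ` by a bijection. Hence `𝔼 ∏ xᵢ ^ aᵢ(σₙ)` is the cycle index `fₙ` of `Sₙ` at
`y_l = ∑ P_Γ(λ) ∏_j x_{lj} ^ a_j(λ)` (`integral_prod_partition_toPerm`).

The class formula for `Sₙ` yields `n fₙ = ∑ y_l f_{n-l}` (`natCast_mul_cycleIndex`). As `y_l = 1`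
for `l` greater than some `L`, this says `∑ fₙ uⁿ = (1 - u)⁻¹ exp (∑_{l ≤ L} (y_l - 1) uˡ / l)`, so
`fₙ` tends to `exp (∑_{l ≤ L} (y_l - 1) / l)` (`tendsto_exp_of_recursion`). By independence, this is
also the generating function of the Poisson sums `Aᵢ` (`integral_prod_pow_cycleSum`).
-/

open scoped Finset Nat

/-! ### Cycles and periodic points of a permutation -/

namespace Equiv.Perm

variable {α : Type*}

theorem minimalPeriod_pos [Finite α] (σ : Perm α) (a : α) : 0 < Function.minimalPeriod σ a :=
  Function.minimalPeriod_pos_of_mem_periodicPts (σ.injective.mem_periodicPts a)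

theorem minimalPeriod_eq_card_support_cycleOf [Fintype α] [DecidableEq α] (σ : Perm α) {a : α}
    (ha : σ a ≠ a) : Function.minimalPeriod σ a = #(σ.cycleOf a).support := by
  have hc : (σ.cycleOf a).IsCycle := isCycle_cycleOf σ ha
  rw [← hc.orderOf]
  have key (n : ℕ) : Function.minimalPeriod σ a ∣ n ↔ orderOf (σ.cycleOf a) ∣ n := by
    rw [← Function.isPeriodicPt_iff_minimalPeriod_dvd, orderOf_dvd_iff_pow_eq_one,
      hc.pow_eq_one_iff' (x := a) (by simpa using ha), cycleOf_pow_apply_self,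
      Function.IsPeriodicPt, Function.IsFixedPt, iterate_eq_pow]
  exact Nat.dvd_antisymm ((key _).2 dvd_rfl) ((key _).1 dvd_rfl)

/-- The chosen representative of the cycle of `σ` through a given point. -/
noncomputable def cycleRep (σ : Perm α) (a : α) : α :=
  (Quotient.mk (SameCycle.setoid σ) a).out

theorem sameCycle_cycleRep (σ : Perm α) (a : α) : σ.SameCycle (σ.cycleRep a) a :=
  Quotient.mk_out (s := SameCycle.setoid σ) a

theorem cycleRep_eq_iff (σ : Perm α) {a b : α} : σ.cycleRep a = σ.cycleRep b ↔ σ.SameCycle a b := by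
  refine ⟨fun h => ?_, fun h => ?_⟩
  · exact (h ▸ σ.sameCycle_cycleRep a).symm.trans (σ.sameCycle_cycleRep b)
  · exact congrArg Quotient.out (Quotient.sound (s := SameCycle.setoid σ) h)

variable [Fintype α] [DecidableEq α]

/-- A set of points that meets every cycle of `σ`, fixed points included, exactly once. -/
noncomputable def cycleReps (σ : Perm α) : Finset α :=
  {a | σ.cycleRep a = a}

theorem mem_cycleReps {σ : Perm α} {a : α} : a ∈ σ.cycleReps ↔ σ.cycleRep a = a := by
  simp [cycleReps]

theorem cycleRep_mem_cycleReps (σ : Perm α) (a : α) : σ.cycleRep a ∈ σ.cycleReps :=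
  mem_cycleReps.2 ((σ.cycleRep_eq_iff).2 (σ.sameCycle_cycleRep a))

theorem eq_of_mem_cycleReps {σ : Perm α} {a b : α} (ha : a ∈ σ.cycleReps) (hb : b ∈ σ.cycleReps)
    (h : σ.SameCycle a b) : a = b := by
  rw [mem_cycleReps] at ha hb
  rw [← ha, ← hb, cycleRep_eq_iff]
  exact h

/-- The parts of the partition attached to a permutation are the periods of the cycle
representatives. -/
theorem partition_parts_eq_map_minimalPeriod (σ : Perm α) :
    σ.partition.parts = σ.cycleReps.val.map (Function.minimalPeriod σ) := by
  have himg : ({a ∈ σ.cycleReps | a ∈ σ.support} : Finset α).image σ.cycleOf =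
      σ.cycleFactorsFinset := by
    ext c
    simp only [Finset.mem_image, Finset.mem_filter]
    constructor
    · rintro ⟨a, ⟨-, ha⟩, rfl⟩
      exact cycleOf_mem_cycleFactorsFinset_iff.2 ha
    · intro hc
      obtain ⟨a, ha⟩ := ((mem_cycleFactorsFinset_iff.1 hc).1).nonempty_support
      have hca : c = σ.cycleOf a := (cycle_is_cycleOf ha hc)
      have haσ : a ∈ σ.support := mem_cycleFactorsFinset_support_le hc ha
      exact ⟨σ.cycleRep a, ⟨σ.cycleRep_mem_cycleReps a,
        (σ.sameCycle_cycleRep a).mem_support_iff.2 haσ⟩,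
        by rw [hca, (σ.sameCycle_cycleRep a).cycleOf_eq]⟩
  have hinj : Set.InjOn σ.cycleOf ({a ∈ σ.cycleReps | a ∈ σ.support} : Finset α) := by
    intro a ha b hb h
    simp only [Finset.coe_filter, Set.mem_ofPred_eq] at ha hb
    exact eq_of_mem_cycleReps ha.1 hb.1
      ((sameCycle_iff_cycleOf_eq_of_mem_support ha.2 hb.2).2 h)
  have hfix : ({a ∈ σ.cycleReps | a ∉ σ.support} : Finset α) = σ.supportᶜ := by
    ext a
    simp only [Finset.mem_filter, Finset.mem_compl, and_iff_right_iff_imp]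
    intro ha
    have h := (σ.sameCycle_cycleRep a).symm
    have hfix : σ a = a := by simpa using ha
    exact mem_cycleReps.2 (h.eq_of_left hfix).symm
  rw [parts_partition, cycleType_def, ← himg, Finset.image_val_of_injOn hinj, Multiset.map_map,
    ← Multiset.filter_add_not (· ∈ σ.support) σ.cycleReps.val, Multiset.map_add]
  congr 1
  · refine Multiset.map_congr rfl fun a ha => ?_
    have ha' := (Multiset.mem_filter.1 ha).2
    exact (σ.minimalPeriod_eq_card_support_cycleOf (mem_support.1 ha')).symm
  · have h1 : Multiset.filter (fun a => a ∉ σ.support) σ.cycleReps.val = σ.supportᶜ.val := by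
      rw [← hfix, Finset.filter_val]
    rw [h1, ← Finset.card_compl, eq_comm, Multiset.eq_replicate]
    refine ⟨by simp, fun b hb => ?_⟩
    obtain ⟨a, ha, rfl⟩ := Multiset.mem_map.1 hb
    rw [Function.minimalPeriod_eq_one_iff_isFixedPt]
    simpa [Function.IsFixedPt] using ha

theorem card_cycleRep_eq {σ : Perm α} {b : α} (hb : b ∈ σ.cycleReps) :
    #{a | σ.cycleRep a = b} = Function.minimalPeriod σ b := by
  have himg : ({a | σ.cycleRep a = b} : Finset α) =
      (Finset.range (Function.minimalPeriod σ b)).image (fun n => σ^[n] b) := by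
    ext a
    rw [mem_cycleReps] at hb
    simp only [Finset.mem_filter, Finset.mem_univ, true_and, Finset.mem_image, Finset.mem_range]
    nth_rewrite 1 [← hb]
    rw [cycleRep_eq_iff]
    constructor
    · intro h
      obtain ⟨n, -, hn⟩ := h.symm.exists_pow_eq'
      refine ⟨n % Function.minimalPeriod σ b, Nat.mod_lt _ (σ.minimalPeriod_pos b), ?_⟩
      rw [Function.iterate_mod_minimalPeriod_eq, iterate_eq_pow, hn]
    · rintro ⟨n, -, rfl⟩
      rw [iterate_eq_pow]
      exact (sameCycle_pow_left.2 (SameCycle.refl _ _))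
  rw [himg, Finset.card_image_of_injOn, Finset.card_range]
  simpa using Function.iterate_injOn_Iio_minimalPeriod (f := σ) (x := b)

/-- A sum over all points of a function that is constant on the cycles, grouped by cycles. -/
theorem sum_eq_sum_cycleReps {M : Type*} [AddCommMonoid M] (σ : Perm α) (f : α → M)
    (hf : ∀ a, f (σ a) = f a) :
    ∑ a, f a = ∑ b ∈ σ.cycleReps, Function.minimalPeriod σ b • f b := by
  have hf' (n : ℕ) (a : α) : f ((σ ^ n) a) = f a := by
    induction n with
    | zero => rfl
    | succ n ih => rw [pow_succ', mul_apply, hf, ih]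
  rw [← Finset.sum_fiberwise_of_maps_to (fun a _ => σ.cycleRep_mem_cycleReps a)]
  refine Finset.sum_congr rfl fun b hb => ?_
  rw [← card_cycleRep_eq hb, ← Finset.sum_const]
  refine Finset.sum_congr rfl fun a ha => ?_
  obtain ⟨n, -, hn⟩ := (σ.sameCycle_cycleRep a).exists_pow_eq'
  rw [← (Finset.mem_filter.1 ha).2, ← hn, hf', hn]

/-- The number of points of period `i` is `i` times the number of cycles of length `i`. -/
theorem card_minimalPeriod_eq (σ : Perm α) (i : ℕ) :
    #{a | Function.minimalPeriod σ a = i} = i * σ.partition.parts.count i := by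
  rw [Finset.card_filter, σ.sum_eq_sum_cycleReps, partition_parts_eq_map_minimalPeriod,
    Multiset.count_map, ← Finset.filter_val, Finset.card_val, Finset.card_filter, Finset.mul_sum]
  · refine Finset.sum_congr rfl fun b _ => ?_
    by_cases h : Function.minimalPeriod σ b = i
    · simp [h]
    · simp [h, Ne.symm h]
  · intro a
    rw [Function.minimalPeriod_apply (σ.injective.mem_periodicPts a)]

end Equiv.Perm

/-! ### Cycles of an element of the wreath product -/

namespace WreathProduct

open Equiv.Perm

variable {k : ℕ} {Γ : Subgroup (Equiv.Perm (Fin k))} {n : ℕ}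

/-- The element of `Γ` by which the `m`-th power of `(γ, h)` moves the points of block `b` to the
block `h^m b`. -/
def holonomy (γ : Fin n → Γ) (h : Equiv.Perm (Fin n)) : ℕ → Fin n → Γ
  | 0, _ => 1
  | m + 1, b => γ (h^[m + 1] b) * holonomy γ h m b

theorem toPerm_iterate (g : WreathProduct Γ n) (m : ℕ) (b : Fin n) (x : Fin k) :
    (toPerm g)^[m] (b, x) =
      (g.right^[m] b, (holonomy g.left g.right m b : Equiv.Perm (Fin k)) x) := by
  induction m with
  | zero => simp [holonomy]
  | succ m ih =>
    rw [Function.iterate_succ_apply', ih, holonomy, Function.iterate_succ_apply']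
    rfl

/-- The cycle product of `(γ, h)` at the block `b`: the permutation that the return map of
`(γ, h)` to the block `b` induces on this block. -/
noncomputable def cycleProduct (γ : Fin n → Γ) (h : Equiv.Perm (Fin n)) (b : Fin n) : Γ :=
  holonomy γ h (Function.minimalPeriod h b) b

theorem toPerm_iterate_mul (g : WreathProduct Γ n) (m : ℕ) (b : Fin n) (x : Fin k) :
    (toPerm g)^[Function.minimalPeriod g.right b * m] (b, x) =
      (b, (cycleProduct g.left g.right b : Equiv.Perm (Fin k))^[m] x) := by
  induction m with
  | zero => simp
  | succ m ih =>
    rw [mul_add_one, add_comm, Function.iterate_add_apply, ih, toPerm_iterate,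
      Function.iterate_minimalPeriod, Function.iterate_succ_apply']
    rfl

theorem minimalPeriod_toPerm (g : WreathProduct Γ n) (b : Fin n) (x : Fin k) :
    Function.minimalPeriod (toPerm g) (b, x) = Function.minimalPeriod g.right b *
      Function.minimalPeriod (cycleProduct g.left g.right b : Equiv.Perm (Fin k)) x := by
  refine Nat.dvd_antisymm ?_ ?_
  · rw [← Function.isPeriodicPt_iff_minimalPeriod_dvd, Function.IsPeriodicPt, Function.IsFixedPt,
      toPerm_iterate_mul, Function.iterate_minimalPeriod]
  · have h := Function.iterate_minimalPeriod (f := toPerm g) (x := (b, x))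
    obtain ⟨m, hm⟩ : Function.minimalPeriod g.right b ∣
        Function.minimalPeriod (toPerm g) (b, x) := by
      rw [toPerm_iterate] at h
      exact Function.IsPeriodicPt.minimalPeriod_dvd (congrArg Prod.fst h)
    rw [hm, toPerm_iterate_mul] at h
    rw [hm]
    exact Nat.mul_dvd_mul_left _ (Function.IsPeriodicPt.minimalPeriod_dvd (congrArg Prod.snd h))

/-- The cycle type of an element of the wreath product: a cycle of length `l` of the block
permutation, whose cycle product has cycle lengths `j₁, j₂, …`, contributes the cycle lengths
`l j₁, l j₂, …`. -/
theorem partition_parts_toPerm (g : WreathProduct Γ n) :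
    (toPerm g).partition.parts = g.right.cycleReps.val.bind fun b =>
      (cycleProduct g.left g.right b : Equiv.Perm (Fin k)).partition.parts.map
        (Function.minimalPeriod g.right b * ·) := by
  ext i
  rcases Nat.eq_zero_or_pos i with rfl | hi
  · rw [Multiset.count_eq_zero_of_notMem, Multiset.count_eq_zero_of_notMem]
    · simp only [Multiset.mem_bind, Multiset.mem_map, not_exists, not_and, mul_eq_zero, not_or]
      exact fun b _ j hj => ⟨(g.right.minimalPeriod_pos b).ne', (Nat.Partition.parts_pos _ hj).ne'⟩
    · exact fun h => (Nat.Partition.parts_pos _ h).ne' rfl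
  refine Nat.eq_of_mul_eq_mul_left hi ?_
  rw [← card_minimalPeriod_eq, Finset.card_filter, Fintype.sum_prod_type,
    g.right.sum_eq_sum_cycleReps, Multiset.count_bind, ← Finset.sum_eq_multiset_sum,
    Finset.mul_sum]
  · refine Finset.sum_congr rfl fun b _ => ?_
    have hb := g.right.minimalPeriod_pos b
    set l := Function.minimalPeriod g.right b
    simp_rw [minimalPeriod_toPerm]
    rw [← Finset.card_filter, smul_eq_mul]
    by_cases hli : l ∣ i
    · obtain ⟨j, rfl⟩ := hli
      rw [Multiset.count_map_eq_count' _ _ (mul_right_injective₀ hb.ne'), mul_assoc,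
        ← card_minimalPeriod_eq]
      simp [l, hb.ne']
    · rw [Multiset.count_eq_zero_of_notMem, Finset.filter_false_of_mem]
      · simp
      · exact fun x _ h => hli ⟨_, h.symm⟩
      · simp only [Multiset.mem_map, not_exists, not_and]
        exact fun j _ h => hli ⟨_, h.symm⟩
  · intro b
    refine (Fintype.sum_equiv (g.left (g.right b) : Equiv.Perm (Fin k)) _ _ fun x => ?_).symm
    rw [← Function.minimalPeriod_apply ((toPerm g).injective.mem_periodicPts (b, x))]
    rfl

theorem holonomy_congr {γ γ' : Fin n → Γ} {h : Equiv.Perm (Fin n)} {b : Fin n} (m : ℕ)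
    (H : ∀ j, j < m → γ (h^[j + 1] b) = γ' (h^[j + 1] b)) :
    holonomy γ h m b = holonomy γ' h m b := by
  induction m with
  | zero => rfl
  | succ m ih =>
    rw [holonomy, holonomy, H m (Nat.lt_succ_self m), ih fun j hj => H j (Nat.lt_succ_of_lt hj)]

/-- Replacing the coordinate of `γ` at each cycle representative of `h` by the cycle product there
is a bijection of `Γⁿ`. -/
theorem bijective_cycleProduct (h : Equiv.Perm (Fin n)) :
    Function.Bijective fun (γ : Fin n → Γ) (b : Fin n) =>
      if b ∈ h.cycleReps then cycleProduct γ h b else γ b := by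
  refine Finite.injective_iff_bijective.1 fun γ γ' H => funext fun b => ?_
  have hnot (c : Fin n) (hc : c ∉ h.cycleReps) : γ c = γ' c := by
    simpa [hc] using congrFun H c
  by_cases hb : b ∈ h.cycleReps
  · have hprod : cycleProduct γ h b = cycleProduct γ' h b := by simpa [hb] using congrFun H b
    obtain ⟨m, hm⟩ := Nat.exists_eq_add_one_of_ne_zero (h.minimalPeriod_pos b).ne'
    have hiter : h^[m + 1] b = b := hm ▸ Function.iterate_minimalPeriod
    rw [cycleProduct, cycleProduct, hm, holonomy, holonomy, hiter] at hprod
    -- The other blocks of the cycle of `b` are not representatives.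
    rw [holonomy_congr (γ := γ) (γ' := γ') m] at hprod
    · exact mul_right_cancel hprod
    · intro j hj
      refine hnot _ fun hmem => ?_
      have hsame : h.SameCycle b (h^[j + 1] b) := by
        rw [iterate_eq_pow]
        exact (sameCycle_pow_right.2 (SameCycle.refl _ _))
      have := eq_of_mem_cycleReps hb hmem hsame
      exact Function.not_isPeriodicPt_of_pos_of_lt_minimalPeriod (Nat.succ_ne_zero j)
        (by omega) this.symm
  · exact hnot b hb

/-- For fixed `h` and uniform `γ`, the cycle products at the cycle representatives of `h` are
independent and uniform on `Γ`. -/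
theorem sum_prod_cycleProduct [Fintype Γ] (h : Equiv.Perm (Fin n)) (w : Fin n → Γ → ℝ) :
    ∑ γ : Fin n → Γ, ∏ b ∈ h.cycleReps, w b (cycleProduct γ h b) =
      (Fintype.card Γ : ℝ) ^ n *
        ∏ b ∈ h.cycleReps, (Fintype.card Γ : ℝ)⁻¹ * ∑ s : Γ, w b s := by
  have hcard : (Fintype.card Γ : ℝ) ≠ 0 := Nat.cast_ne_zero.2 Fintype.card_ne_zero
  calc ∑ γ : Fin n → Γ, ∏ b ∈ h.cycleReps, w b (cycleProduct γ h b)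
    _ = ∑ γ : Fin n → Γ, ∏ b, if b ∈ h.cycleReps then w b (γ b) else 1 := by
      refine Fintype.sum_bijective _ (bijective_cycleProduct h) _ _ fun γ => ?_
      rw [Finset.prod_ite_mem, Finset.univ_inter]
      exact Finset.prod_congr rfl fun b hb => by simp [hb]
    _ = ∏ b, ∑ s : Γ, if b ∈ h.cycleReps then w b s else 1 := by
      rw [Finset.prod_univ_sum, Fintype.piFinset_univ]
    _ = ∏ b, (Fintype.card Γ : ℝ) *
          if b ∈ h.cycleReps then (Fintype.card Γ : ℝ)⁻¹ * ∑ s : Γ, w b s else 1 := by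
      refine Finset.prod_congr rfl fun b _ => ?_
      split_ifs
      · rw [mul_inv_cancel_left₀ hcard]
      · simp
    _ = _ := by
      rw [Finset.prod_mul_distrib, Finset.prod_ite_mem, Finset.univ_inter]
      simp

end WreathProduct

/-! ### The cycle index of the symmetric group -/

/-- The order `∏ i ^ mᵢ mᵢ!` of the centralizer of a permutation with `mᵢ` cycles of length `i`,
where `mᵢ` is the multiplicity of `i` in `s`. -/
def centralizerOrder (s : Multiset ℕ) : ℕ :=
  s.prod * ∏ i ∈ s.toFinset, (s.count i)!

theorem prod_factorial_count_of_subset {s : Multiset ℕ} {u : Finset ℕ} (h : s.toFinset ⊆ u) :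
    ∏ i ∈ s.toFinset, (s.count i)! = ∏ i ∈ u, (s.count i)! := by
  refine Finset.prod_subset h fun i _ hi => ?_
  rw [Multiset.count_eq_zero_of_notMem (by simpa using hi), Nat.factorial_zero]

theorem centralizerOrder_cons (a : ℕ) (s : Multiset ℕ) :
    centralizerOrder (a ::ₘ s) = a * (s.count a + 1) * centralizerOrder s := by
  have hu : s.toFinset ⊆ (a ::ₘ s).toFinset := by
    rw [Multiset.toFinset_cons]
    exact Finset.subset_insert _ _
  have ha : a ∈ (a ::ₘ s).toFinset := by simp
  rw [centralizerOrder, centralizerOrder, prod_factorial_count_of_subset hu, Multiset.prod_cons,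
    ← Finset.mul_prod_erase _ _ ha, ← Finset.mul_prod_erase _ _ ha, Multiset.count_cons_self,
    Nat.factorial_succ]
  rw [Finset.prod_congr rfl fun i hi => by
    rw [Multiset.count_cons_of_ne (Finset.ne_of_mem_erase hi)]]
  ring

theorem centralizerOrder_pos {s : Multiset ℕ} (hs : ∀ i ∈ s, 0 < i) : 0 < centralizerOrder s :=
  Nat.mul_pos (Nat.pos_of_ne_zero fun h => (hs 0 (Multiset.prod_eq_zero_iff.1 h)).ne' rfl)
    (Finset.prod_pos fun _ _ => Nat.factorial_pos _)

/-- The class formula `n! / ∏ i ^ mᵢ mᵢ!` for the number of permutations of given cycle type, fixed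
points counted as parts. -/
theorem card_partition_parts_eq_mul {α : Type*} [Fintype α] [DecidableEq α] {s : Multiset ℕ}
    (hpos : ∀ i ∈ s, 0 < i) (hsum : s.sum = Fintype.card α) :
    #{h : Equiv.Perm α | h.partition.parts = s} * centralizerOrder s = (Fintype.card α)! := by
  set m := s.filter (2 ≤ ·)
  set r := Multiset.card (s.filter (¬ 2 ≤ ·))
  have hr : s.filter (¬ 2 ≤ ·) = Multiset.replicate r 1 := by
    refine Multiset.eq_replicate_card.2 fun i hi => ?_
    have h := Multiset.mem_filter.1 hi
    have := hpos i h.1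
    omega
  have hs : s = m + Multiset.replicate r 1 := by
    rw [← hr, Multiset.filter_add_not]
  have hcard : m.sum + r = Fintype.card α := by
    rw [← hsum, hs]
    simp
  have hm (i : ℕ) (hi : i ∈ m) : 2 ≤ i := (Multiset.mem_filter.1 hi).2
  have hone : 1 ∉ m := fun h => by simpa using hm 1 h
  have hset : ({h : Equiv.Perm α | h.partition.parts = s} : Finset _) =
      ({h : Equiv.Perm α | h.cycleType = m} : Finset _) := by
    ext h
    simp only [Finset.mem_filter, Finset.mem_univ, true_and]
    refine ⟨fun H => by rw [← Equiv.Perm.filter_parts_partition_eq_cycleType, H], fun H => ?_⟩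
    rw [Equiv.Perm.parts_partition, ← h.sum_cycleType, H, hs]
    congr 2
    omega
  have hz : centralizerOrder s = (Fintype.card α - m.sum)! * m.prod *
      ∏ i ∈ m.toFinset, (m.count i)! := by
    have hsub : s.toFinset ⊆ insert 1 m.toFinset := by
      intro i hi
      rw [Multiset.mem_toFinset, hs, Multiset.mem_add] at hi
      rcases hi with hi | hi
      · simp [hi]
      · simp [Multiset.eq_of_mem_replicate hi]
    rw [centralizerOrder, prod_factorial_count_of_subset hsub, Finset.prod_insert (by simpa),
      show Fintype.card α - m.sum = r by omega]
    have h1 : s.count 1 = r := by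
      rw [hs, Multiset.count_add, Multiset.count_eq_zero_of_notMem hone]
      simp
    have h2 : s.prod = m.prod := by
      rw [hs]
      simp
    rw [h1, h2, Finset.prod_congr rfl fun i hi => ?_]
    · ring
    · have hne : (1 : ℕ) ≠ i := by
        rintro rfl
        exact hone (by simpa using hi)
      rw [hs, Multiset.count_add, Multiset.count_replicate, if_neg hne, add_zero]
  rw [hset, hz, Equiv.Perm.card_of_cycleType_mul_eq, if_pos ⟨by omega, hm⟩]

/-- The cycle index of the symmetric group `Sₙ`, evaluated at the variables `y₁, y₂, …`. -/
noncomputable def cycleIndex (y : ℕ → ℝ) (n : ℕ) : ℝ :=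
  ∑ p : n.Partition, (p.parts.map y).prod / centralizerOrder p.parts

theorem sum_perm_prod_partition (y : ℕ → ℝ) (n : ℕ) :
    ∑ h : Equiv.Perm (Fin n), (h.partition.parts.map y).prod = n ! * cycleIndex y n := by
  have hcard : Fintype.card (Fin n) = n := Fintype.card_fin n
  have hmain : ∑ h : Equiv.Perm (Fin n), (h.partition.parts.map y).prod =
      (Fintype.card (Fin n))! * cycleIndex y (Fintype.card (Fin n)) := by
    rw [cycleIndex, Finset.mul_sum,
      ← Finset.sum_fiberwise_of_maps_to (t := (Finset.univ : Finset (Nat.Partition _)))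
        (g := fun h : Equiv.Perm (Fin n) => h.partition) fun h _ => Finset.mem_univ _]
    refine Finset.sum_congr rfl fun p _ => ?_
    have hz : (centralizerOrder p.parts : ℝ) ≠ 0 :=
      Nat.cast_ne_zero.2 (centralizerOrder_pos fun i hi => p.parts_pos hi).ne'
    rw [← card_partition_parts_eq_mul (fun i hi => p.parts_pos hi) p.parts_sum,
      Finset.sum_congr rfl fun h hh => by rw [(Finset.mem_filter.1 hh).2], Finset.sum_const,
      nsmul_eq_mul]
    simp_rw [Nat.Partition.ext_iff]
    push_cast
    field_simp
  simpa only [hcard] using hmain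

theorem cycleIndex_zero (y : ℕ → ℝ) : cycleIndex y 0 = 1 := by
  simp [cycleIndex, centralizerOrder]

/-- Marking one of the `n` points and removing the cycle through it. For partitions: marking one of
the `l m_l` points that lie in parts `l`, and removing a part `l`. -/
theorem natCast_mul_cycleIndex (y : ℕ → ℝ) (n : ℕ) :
    n * cycleIndex y n = ∑ l ∈ Finset.Icc 1 n, y l * cycleIndex y (n - l) := by
  have hn (p : n.Partition) : (n : ℝ) = ∑ l ∈ Finset.Icc 1 n, (p.parts.count l : ℝ) * l := by
    have h := Finset.sum_multiset_count_of_subset p.parts (Finset.Icc 1 n) fun i hi => by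
      rw [Multiset.mem_toFinset] at hi
      exact Finset.mem_Icc.2 ⟨p.parts_pos hi, p.le_of_mem_parts hi⟩
    rw [p.parts_sum] at h
    simp only [smul_eq_mul] at h
    exact_mod_cast h
  simp_rw [cycleIndex, Finset.mul_sum]
  rw [Finset.sum_congr rfl fun p _ => by rw [hn p, Finset.sum_mul], Finset.sum_comm]
  refine Finset.sum_congr rfl fun l hl => ?_
  obtain ⟨hl1, hln⟩ := Finset.mem_Icc.1 hl
  -- Partitions of `n` with a part `l` are partitions of `n - l` with a part `l` added.
  let e (q : (n - l).Partition) : n.Partition :=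
    { parts := l ::ₘ q.parts
      parts_pos := fun {i} hi => by
        rcases Multiset.mem_cons.1 hi with rfl | hi
        exacts [hl1, q.parts_pos hi]
      parts_sum := by rw [Multiset.sum_cons, q.parts_sum]; omega }
  refine (Finset.sum_of_injOn e ?_ (fun _ _ => Finset.mem_coe.2 (Finset.mem_univ _)) ?_ ?_).symm
  · intro q _ q' _ h
    exact Nat.Partition.ext ((Multiset.cons_inj_right l).1 (congrArg Nat.Partition.parts h))
  · intro p _ hp
    rw [Multiset.count_eq_zero_of_notMem, Nat.cast_zero, zero_mul, zero_mul]
    intro hmem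
    refine hp ⟨⟨p.parts.erase l, fun hi => p.parts_pos (Multiset.mem_of_mem_erase hi), ?_⟩,
      Finset.mem_coe.2 (Finset.mem_univ _), Nat.Partition.ext (Multiset.cons_erase hmem)⟩
    have h := congrArg Multiset.sum (Multiset.cons_erase hmem)
    rw [Multiset.sum_cons, p.parts_sum] at h
    omega
  · intro q _
    have hz : (centralizerOrder q.parts : ℝ) ≠ 0 :=
      Nat.cast_ne_zero.2 (centralizerOrder_pos fun i hi => q.parts_pos hi).ne'
    have hl0 : (l : ℝ) ≠ 0 := Nat.cast_ne_zero.2 (by omega)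
    simp only [e, Multiset.map_cons, Multiset.prod_cons, centralizerOrder_cons,
      Multiset.count_cons_self]
    push_cast
    field_simp

/-! ### Asymptotics of the recursion -/

namespace PowerSeries

/-- The power series `exp (c X ^ l / l)`, given by its value at `1`, where it converges absolutely,
and by its differential equation. -/
theorem exists_exp_monomial (c : ℝ) {l : ℕ} (hl : 0 < l) :
    ∃ E : PowerSeries ℝ, Summable (fun n => ‖coeff n E‖) ∧ ∑' n, coeff n E = Real.exp (c / l) ∧
      constantCoeff E = 1 ∧ X * d⁄dX ℝ E = C c * X ^ l * E := by
  have hl0 : (l : ℝ) ≠ 0 := Nat.cast_ne_zero.2 hl.ne'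
  have hinj : Function.Injective (l * ·) := mul_right_injective₀ hl.ne'
  set a : ℕ → ℝ := fun n => if l ∣ n then (c / l) ^ (n / l) / (n / l)! else 0
  have hsupp : ∀ n, n ∉ Set.range (l * ·) → a n = 0 := by
    intro n hn
    exact if_neg fun ⟨m, hm⟩ => hn ⟨m, hm.symm⟩
  have hcomp (m : ℕ) : a (l * m) = (c / l) ^ m / m ! := by
    simp [a, Nat.mul_div_cancel_left _ hl]
  have hsum : HasSum a (Real.exp (c / l)) := by
    rw [← hinj.hasSum_iff hsupp]
    simp_rw [Function.comp_def, hcomp, Real.exp_eq_exp_ℝ]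
    exact NormedSpace.expSeries_div_hasSum_exp (c / l)
  refine ⟨mk a, ?_, by simpa using hsum.tsum_eq, ?_, ?_⟩
  · simpa using hsum.summable.abs
  · simpa using hcomp 0
  · ext n
    rw [mul_assoc, coeff_C_mul, coeff_X_pow_mul', coeff_mk]
    rcases n with - | n
    · rw [coeff_zero_X_mul, if_neg (by omega), mul_zero]
    rw [coeff_succ_X_mul, coeff_derivative, coeff_mk]
    by_cases hd : l ∣ n + 1
    · obtain ⟨m, hm⟩ := hd
      rcases m with - | m
      · omega
      have hle : l ≤ n + 1 := by rw [hm]; exact Nat.le_mul_of_pos_right _ (Nat.succ_pos _)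
      have hsub : n + 1 - l = l * m := by rw [hm, mul_add_one, Nat.add_sub_cancel]
      have hcast : (n : ℝ) + 1 = l * (m + 1) := by exact_mod_cast hm
      rw [if_pos hle, hsub, hcast, hm, hcomp, hcomp, Nat.factorial_succ]
      push_cast
      field_simp
      rw [pow_succ]
      field_simp
    · rw [show a (n + 1) = 0 from if_neg hd, zero_mul]
      split_ifs with hle
      · rw [show a (n + 1 - l) = 0 from if_neg fun h => hd ?_, mul_zero]
        simpa [Nat.sub_add_cancel hle] using Nat.dvd_add h dvd_rfl
      · simp

/-- The power series `exp (∑ c_l X ^ l / l)`, a finite product of exponentials of monomials. -/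
theorem exists_exp_polynomial (c : ℕ → ℝ) (L : ℕ) :
    ∃ H : PowerSeries ℝ, Summable (fun n => ‖coeff n H‖) ∧
      ∑' n, coeff n H = Real.exp (∑ l ∈ Finset.Icc 1 L, c l / l) ∧
      constantCoeff H = 1 ∧
      X * d⁄dX ℝ H = (∑ l ∈ Finset.Icc 1 L, C (c l) * X ^ l) * H := by
  induction L with
  | zero =>
    refine ⟨1, ?_, ?_, by simp, by simp⟩
    · refine summable_of_ne_finset_zero (s := {0}) fun n hn => ?_
      rw [coeff_one, if_neg (by simpa using hn), norm_zero]
    · rw [tsum_eq_single 0 fun n hn => by rw [coeff_one, if_neg hn]]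
      simp
  | succ L ih =>
    obtain ⟨H, hs, ht, h0, hd⟩ := ih
    obtain ⟨E, es, et, e0, ed⟩ := exists_exp_monomial (c (L + 1)) (Nat.succ_pos L)
    refine ⟨H * E, ?_, ?_, by rw [map_mul, h0, e0, one_mul], ?_⟩
    · simpa only [coeff_mul] using summable_norm_sum_mul_antidiagonal_of_summable_norm hs es
    · simp only [coeff_mul]
      rw [← tsum_mul_tsum_eq_tsum_sum_antidiagonal_of_summable_norm hs es, ht, et, ← Real.exp_add,
        Finset.sum_Icc_succ_top (Nat.succ_pos L)]
    · rw [Derivation.leibniz, smul_eq_mul, smul_eq_mul, mul_add,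
        Finset.sum_Icc_succ_top (Nat.succ_pos L), add_mul]
      rw [Nat.succ_eq_add_one] at ed
      linear_combination E * hd + H * ed

end PowerSeries

open PowerSeries in
/-- If `n fₙ = ∑ y_l f_{n-l}` and `y_l = 1` for `l > L`, then `∑ fₙ uⁿ` is
`(1 - u)⁻¹ exp (∑_{l ≤ L} (y_l - 1) u ^ l / l)`, so that `fₙ` is a partial sum of the coefficients
of the exponential. -/
theorem tendsto_exp_of_recursion {f y : ℕ → ℝ} (h0 : f 0 = 1)
    (hf : ∀ n : ℕ, n * f n = ∑ l ∈ Finset.Icc 1 n, y l * f (n - l)) {L : ℕ}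
    (hy : ∀ l, L < l → y l = 1) :
    Tendsto f atTop (nhds (Real.exp (∑ l ∈ Finset.Icc 1 L, (y l - 1) / l))) := by
  obtain ⟨H, hs, ht, hH0, hd⟩ := exists_exp_polynomial (fun l => y l - 1) L
  set I : PowerSeries ℝ := mk 1
  have hI : I * (1 - X) = 1 := mk_one_mul_one_sub_eq_one ℝ
  have hdI : d⁄dX ℝ I = I * I := by
    have h := congrArg (d⁄dX ℝ) hI
    rw [Derivation.leibniz, map_sub, Derivation.map_one_eq_zero, derivative_X, smul_eq_mul,
      smul_eq_mul] at h
    linear_combination I * h - d⁄dX ℝ I * hI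
  set Y : PowerSeries ℝ := mk fun l => if l = 0 then 0 else y l
  have hY : Y = (∑ l ∈ Finset.Icc 1 L, C (y l - 1) * X ^ l) + X * I := by
    ext n
    simp only [map_add, map_sum, coeff_C_mul, coeff_X_pow, Y, coeff_mk, mul_ite, mul_one, mul_zero,
      Finset.sum_ite_eq, Finset.mem_Icc]
    rcases n with - | n
    · simp
    · rw [coeff_succ_X_mul, coeff_mk, if_neg (Nat.succ_ne_zero n), Pi.one_apply]
      split_ifs with hn
      · ring
      · rw [hy _ (by omega)]
        ring
  have hdG : X * d⁄dX ℝ (H * I) = Y * (H * I) := by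
    rw [Derivation.leibniz, smul_eq_mul, smul_eq_mul, hdI, hY]
    linear_combination I * hd
  have hG (n : ℕ) : n * coeff n (H * I) =
      ∑ l ∈ Finset.Icc 1 n, y l * coeff (n - l) (H * I) := by
    rcases n with - | n
    · simp
    have h := congrArg (coeff (n + 1)) hdG
    rw [coeff_succ_X_mul, coeff_derivative, coeff_mul (n + 1) Y,
      Finset.Nat.sum_antidiagonal_eq_sum_range_succ
      (fun i j => coeff i Y * coeff j (H * I)), Finset.sum_range_succ'] at h
    rw [← Finset.Ico_add_one_right_eq_Icc, Finset.sum_Ico_eq_sum_range]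
    simp only [Y, coeff_mk, if_pos, zero_mul, add_zero, Nat.succ_ne_zero, if_false,
      add_tsub_cancel_right] at h ⊢
    push_cast
    rw [mul_comm, h]
    exact Finset.sum_congr rfl fun i _ => by rw [add_comm 1 i]
  have hfG (n : ℕ) : f n = coeff n (H * I) := by
    induction n using Nat.strong_induction_on with
    | _ n ih =>
      rcases Nat.eq_zero_or_pos n with rfl | hn
      · simp [h0, hH0, I]
      · refine mul_left_cancel₀ (Nat.cast_ne_zero.2 hn.ne' : (n : ℝ) ≠ 0) ?_
        rw [hf, hG]
        refine Finset.sum_congr rfl fun l hl => ?_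
        rw [ih _ (by have := Finset.mem_Icc.1 hl; omega)]
  have hpartial (n : ℕ) : f n = ∑ j ∈ Finset.range (n + 1), coeff j H := by
    rw [hfG, coeff_mul, Finset.Nat.sum_antidiagonal_eq_sum_range_succ
      (fun i j => coeff i H * coeff j I)]
    simp [I]
  rw [funext hpartial, ← ht]
  exact (tendsto_add_atTop_iff_nat 1).2 hs.of_norm.hasSum.tendsto_sum_nat

/-! ### Weak convergence from generating functions -/

open BoundedContinuousFunction Topology

/-- The number `1/2` as an element of the unit interval. -/
noncomputable def unitInterval.half : unitInterval := ⟨1 / 2, by norm_num, by norm_num⟩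

theorem unitInterval.coe_half_pow (a : ℕ) : ((half ^ a : unitInterval) : ℝ) = (1 / 2) ^ a := by
  simp [half]

theorem isInducing_half_pow : IsInducing fun a : ℕ => unitInterval.half ^ a := by
  have hlt {a b : ℕ} : (1 / 2 : ℝ) ^ a < (1 / 2) ^ b ↔ b < a :=
    pow_lt_pow_iff_right_of_lt_one₀ (by norm_num) (by norm_num)
  constructor
  rw [DiscreteTopology.eq_bot (α := ℕ), eq_comm]
  refine eq_bot_of_singletons_open fun a => isOpen_induced_iff.2
    ⟨{t | (1 / 2 : ℝ) ^ (a + 1) < t ∧ (t : ℝ) * (1 / 2) < (1 / 2) ^ a}, ?_, ?_⟩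
  · exact (isOpen_lt continuous_const continuous_subtype_val).inter
      (isOpen_lt (continuous_subtype_val.mul continuous_const) continuous_const)
  · ext b
    simp only [Set.mem_preimage, Set.mem_ofPred_eq, unitInterval.coe_half_pow, ← pow_succ, hlt,
      Set.mem_singleton_iff]
    omega

/-- Joint probability generating functions, at arguments `2 ^ (-mᵢ)` of which all but finitely many
are `1`, determine weak convergence of families of natural numbers. -/
theorem tendsto_of_forall_tendsto_pgf {ι : Type*} [Countable ι]
    {μ : ℕ → ProbabilityMeasure (ι → ℕ)} {μ₀ : ProbabilityMeasure (ι → ℕ)}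
    (h : ∀ m : ι →₀ ℕ, Tendsto
      (fun n => ∫ a, ∏ i ∈ m.support, ((1 / 2 : ℝ) ^ m i) ^ a i ∂(μ n : Measure (ι → ℕ))) atTop
      (𝓝 (∫ a, ∏ i ∈ m.support, ((1 / 2 : ℝ) ^ m i) ^ a i ∂(μ₀ : Measure (ι → ℕ))))) :
    Tendsto μ atTop (𝓝 μ₀) := by
  set Φ : (ι → ℕ) → (ι → unitInterval) := fun a i => unitInterval.half ^ a i
  have hΦ : IsInducing Φ := IsInducing.piMap fun _ => isInducing_half_pow
  have hΦm : Measurable Φ := hΦ.continuous.measurable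
  -- The monomials in the coordinates of the cube; their linear span is a subalgebra.
  let S : Submonoid ((ι → unitInterval) →ᵇ ℝ) :=
    { carrier := {g | ∃ m : ι →₀ ℕ, ∀ t, g t = m.prod fun i e => (t i : ℝ) ^ e}
      one_mem' := ⟨0, by simp⟩
      mul_mem' := by
        classical
        rintro g₁ g₂ ⟨m₁, h₁⟩ ⟨m₂, h₂⟩
        refine ⟨m₁ + m₂, fun t => ?_⟩
        rw [Finsupp.prod_add_index' (by simp) (by simp [pow_add]), ← h₁, ← h₂]
        rfl }
  let A : StarSubalgebra ℝ ((ι → unitInterval) →ᵇ ℝ) :=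
    { Algebra.adjoin ℝ (S : Set ((ι → unitInterval) →ᵇ ℝ)) with
      star_mem' := fun {g} hg => by
        have : star g = g := by ext; simp
        rwa [this] }
  have key : Tendsto (fun n => (μ n).map hΦm.aemeasurable) atTop (𝓝 (μ₀.map hΦm.aemeasurable)) := by
    refine ProbabilityMeasure.tendsto_of_tight_of_separatesPoints ℝ (A := A)
      .of_compactSpace ?_ ?_
    · intro x y hxy
      obtain ⟨i, hi⟩ := Function.ne_iff.1 hxy
      let g : (ι → unitInterval) →ᵇ ℝ := mkOfCompact ⟨fun t => (t i : ℝ), by fun_prop⟩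
      have hg : g ∈ A := Algebra.subset_adjoin ⟨Finsupp.single i 1, fun t => by simp [g]⟩
      refine ⟨g, ⟨_, ⟨g, hg, rfl⟩, rfl⟩, ?_⟩
      simpa [g, Subtype.ext_iff] using hi
    · intro g hg
      have hg' : g ∈ Submodule.span ℝ (S : Set ((ι → unitInterval) →ᵇ ℝ)) := by
        have h1 : g ∈ Subalgebra.toSubmodule (Algebra.adjoin ℝ (S : Set _)) := hg
        rwa [Algebra.adjoin_eq_span, Submonoid.closure_eq] at h1
      clear hg
      induction hg' using Submodule.span_induction with
      | mem g hg =>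
        obtain ⟨m, hm⟩ := hg
        have hint (ν : ProbabilityMeasure (ι → ℕ)) :
            ∫ t, g t ∂(ν.map hΦm.aemeasurable : Measure (ι → unitInterval)) =
              ∫ a, ∏ i ∈ m.support, ((1 / 2 : ℝ) ^ m i) ^ a i ∂(ν : Measure (ι → ℕ)) := by
          rw [ProbabilityMeasure.toMeasure_map, integral_map hΦm.aemeasurable
            g.continuous.aestronglyMeasurable]
          simp_rw [hm, Φ, Finsupp.prod, unitInterval.coe_half_pow, pow_right_comm]
        simpa only [hint] using h m
      | zero => simp
      | add g₁ g₂ _ _ h₁ h₂ =>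
        have hint (ν : ProbabilityMeasure (ι → unitInterval)) :
            ∫ t, (g₁ + g₂) t ∂(ν : Measure (ι → unitInterval)) =
              ∫ t, g₁ t ∂(ν : Measure (ι → unitInterval)) +
                ∫ t, g₂ t ∂(ν : Measure (ι → unitInterval)) :=
          integral_add (g₁.integrable _) (g₂.integrable _)
        simpa only [hint] using h₁.add h₂
      | smul c g _ h =>
        have hint (ν : ProbabilityMeasure (ι → unitInterval)) :
            ∫ t, (c • g) t ∂(ν : Measure (ι → unitInterval)) =
              c * ∫ t, g t ∂(ν : Measure (ι → unitInterval)) :=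
          integral_const_mul c _
        simpa only [hint] using h.const_mul c
  refine tendsto_of_forall_isOpen_le_liminf' fun G hG => ?_
  obtain ⟨V, hV, rfl⟩ := hΦ.isOpen_iff.1 hG
  have := ProbabilityMeasure.le_liminf_measure_open_of_tendsto key hV
  simpa [Measure.map_apply hΦm hV.measurableSet] using this

/-! ### Generating functions of the cycle counts -/

theorem Multiset.prod_map_eq_prod_pow_count {s : Multiset ℕ} (hs : ∀ i ∈ s, 0 < i) {x : ℕ → ℝ}
    {T : Finset ℕ+} (hx : ∀ i : ℕ+, i ∉ T → x i = 1) :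
    (s.map x).prod = ∏ i ∈ T, x i ^ s.count (i : ℕ) := by
  have hT : ∏ i ∈ T, x i ^ s.count (i : ℕ) =
      ∏ i ∈ T.map ⟨_, PNat.coe_injective⟩, x i ^ s.count i := by
    rw [Finset.prod_map]
    rfl
  rw [Finset.prod_multiset_map_count, hT, Finset.prod_subset Finset.subset_union_left, eq_comm,
    Finset.prod_subset Finset.subset_union_right]
  · intro i hi hiT
    rcases Finset.mem_union.1 hi with hi | hi
    · have hpos := hs i (Multiset.mem_toFinset.1 hi)
      have hxi : x i = 1 := hx ⟨i, hpos⟩ fun h => hiT (Finset.mem_map.2 ⟨_, h, rfl⟩)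
      rw [hxi, one_pow]
    · exact absurd hi hiT
  · intro i _ hi
    rw [Multiset.count_eq_zero_of_notMem (by simpa using hi), pow_zero]

/-- Averaging over `Γ` a function of the cycle type. -/
theorem average_cycleType {k : ℕ} (Γ : Subgroup (Equiv.Perm (Fin k))) [Fintype Γ]
    (F : Multiset ℕ → ℝ) :
    (Fintype.card Γ : ℝ)⁻¹ * ∑ s : Γ, F (s : Equiv.Perm (Fin k)).partition.parts =
      ∑ lam : k.Partition, (cycleTypeProb Γ lam : ℝ) * F lam.parts := by
  classical
  let t (s : Γ) : k.Partition :=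
    ⟨(s : Equiv.Perm (Fin k)).partition.parts, fun hi => Nat.Partition.parts_pos _ hi,
      by rw [Nat.Partition.parts_sum, Fintype.card_fin]⟩
  rw [← Finset.sum_fiberwise_of_maps_to (t := Finset.univ) (g := t) fun s _ => Finset.mem_univ _,
    Finset.mul_sum]
  refine Finset.sum_congr rfl fun lam _ => ?_
  have hF : ∀ s ∈ ({s | t s = lam} : Finset Γ),
      F (s : Equiv.Perm (Fin k)).partition.parts = F lam.parts :=
    fun s hs => congrArg F (congrArg Nat.Partition.parts (Finset.mem_filter.1 hs).2)
  rw [Finset.sum_congr rfl hF, Finset.sum_const, nsmul_eq_mul, cycleTypeProb,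
    Nat.card_eq_fintype_card, Nat.card_eq_fintype_card,
    Fintype.card_subtype fun s : Γ => (s : Equiv.Perm (Fin k)).partition.parts = lam.parts]
  have hset : ({s | t s = lam} : Finset Γ) =
      ({s : Γ | (s : Equiv.Perm (Fin k)).partition.parts = lam.parts} : Finset Γ) :=
    Finset.filter_congr fun s _ => Nat.Partition.ext_iff
  rw [hset]
  push_cast
  ring

theorem sum_cycleTypeProb {k : ℕ} (Γ : Subgroup (Equiv.Perm (Fin k))) :
    ∑ lam : k.Partition, (cycleTypeProb Γ lam : ℝ) = 1 := by
  have := Fintype.ofFinite Γ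
  have h := average_cycleType Γ fun _ => 1
  simpa using h.symm

/-- The mean contribution to `∏ xᵢ ^ aᵢ` of a cycle of `l` blocks whose cycle product is uniform on
`Γ`. -/
noncomputable def blockWeight {k : ℕ} (Γ : Subgroup (Equiv.Perm (Fin k))) (x : ℕ → ℝ) (l : ℕ) : ℝ :=
  ∑ lam : k.Partition, (cycleTypeProb Γ lam : ℝ) * (lam.parts.map fun j => x (l * j)).prod

theorem integral_uniformOn_univ {α : Type*} [Fintype α] [MeasurableSpace α]
    [DiscreteMeasurableSpace α] (f : α → ℝ) :
    ∫ a, f a ∂(uniformOn (Set.univ : Set α)) = (Fintype.card α : ℝ)⁻¹ * ∑ a, f a := by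
  rw [uniformOn, ProbabilityTheory.cond, Measure.restrict_univ, integral_smul_measure,
    integral_count]
  simp

/-- The cycle generating function of the wreath product is the cycle index of `Sₙ` at the block
weights. -/
theorem integral_prod_partition_toPerm {k : ℕ} (Γ : Subgroup (Equiv.Perm (Fin k))) (n : ℕ)
    (x : ℕ → ℝ) :
    ∫ g, ((WreathProduct.toPerm g).partition.parts.map x).prod
      ∂(uniformOn (Set.univ : Set (WreathProduct Γ n))) = cycleIndex (blockWeight Γ x) n := by
  classical
  have := Fintype.ofFinite Γ
  have := Fintype.ofFinite (WreathProduct Γ n)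
  have hcard : (Fintype.card (WreathProduct Γ n) : ℝ) = (Fintype.card Γ : ℝ) ^ n * n ! := by
    rw [Fintype.card_congr SemidirectProduct.equivProd]
    simp [Fintype.card_perm]
  rw [integral_uniformOn_univ, hcard, ← SemidirectProduct.equivProd.symm.sum_comp,
    Fintype.sum_prod_type_right]
  have hpart (γ : Fin n → Γ) (h : Equiv.Perm (Fin n)) :
      ((WreathProduct.toPerm (⟨γ, h⟩ : WreathProduct Γ n)).partition.parts.map x).prod =
        ∏ b ∈ h.cycleReps,
          ((WreathProduct.cycleProduct γ h b : Equiv.Perm (Fin k)).partition.parts.map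
            fun j => x (Function.minimalPeriod h b * j)).prod := by
    rw [WreathProduct.partition_parts_toPerm, Multiset.map_bind, Multiset.prod_bind]
    simp only [Multiset.map_map]
    rfl
  have hinner (h : Equiv.Perm (Fin n)) :
      ∑ γ : Fin n → Γ, ((WreathProduct.toPerm (⟨γ, h⟩ : WreathProduct Γ n)).partition.parts.map
        x).prod = (Fintype.card Γ : ℝ) ^ n * (h.partition.parts.map (blockWeight Γ x)).prod := by
    rw [Equiv.Perm.partition_parts_eq_map_minimalPeriod, Multiset.map_map,
      Finset.sum_congr rfl fun γ _ => hpart γ h,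
      WreathProduct.sum_prod_cycleProduct h fun b (s : Γ) =>
      ((s : Equiv.Perm (Fin k)).partition.parts.map
        fun j => x (Function.minimalPeriod h b * j)).prod]
    congr 1
    refine Finset.prod_congr rfl fun b _ => ?_
    exact average_cycleType Γ fun s => (s.map fun j => x (Function.minimalPeriod h b * j)).prod
  refine (congrArg _ (Finset.sum_congr rfl fun h _ => hinner h)).trans ?_
  rw [← Finset.mul_sum, sum_perm_prod_partition]
  have h1 : (Fintype.card Γ : ℝ) ≠ 0 := Nat.cast_ne_zero.2 Fintype.card_ne_zero
  have h2 : (n ! : ℝ) ≠ 0 := Nat.cast_ne_zero.2 n.factorial_ne_zero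
  field_simp

/-- The weights of all `i` beyond the truncation at `L` are `1`, so that the sum over the
factorizations `i = j l` in `cycleSum` becomes a product over all pairs `j, l ≤ L`. -/
theorem prod_pow_cycleSum {k : ℕ} (z : ℕ+ → k.Partition → ℕ) {x : ℕ → ℝ} {L : ℕ+}
    (hx : ∀ i : ℕ, L < i → x i = 1) :
    ∏ i ∈ Finset.Icc 1 L, x i ^ cycleSum z i =
      ∏ l ∈ Finset.Icc 1 L, ∏ lam : k.Partition,
        (lam.parts.map fun j => x (l * j)).prod ^ z l lam := by
  have hle {a b : ℕ+} : b ≤ a * b := by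
    rw [← PNat.coe_le_coe, PNat.mul_coe]
    exact Nat.le_mul_of_pos_left _ a.pos
  have hle' {a b : ℕ+} : a ≤ a * b := mul_comm a b ▸ hle
  simp_rw [cycleSum, ← Finset.prod_pow_eq_pow_sum]
  rw [Finset.prod_comm, Finset.prod_comm (s := Finset.Icc 1 L) (t := Finset.univ)]
  refine Finset.prod_congr rfl fun lam _ => ?_
  set T := Finset.Icc 1 L
  have hdiv (i : ℕ+) (hi : i ∈ T) :
      (Finset.Icc (1 : ℕ+) i ×ˢ Finset.Icc (1 : ℕ+) i).filter (fun p => p.1 * p.2 = i) =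
        (T ×ˢ T).filter (fun p => p.1 * p.2 = i) := by
    ext p
    simp only [T, Finset.mem_filter, Finset.mem_product, Finset.mem_Icc, one_le, true_and]
      at hi ⊢
    constructor
    · rintro ⟨⟨h1, h2⟩, h3⟩
      exact ⟨⟨h1.trans hi, h2.trans hi⟩, h3⟩
    · rintro ⟨-, rfl⟩
      exact ⟨⟨hle', hle⟩, rfl⟩
  calc _ = ∏ i ∈ T, ∏ p ∈ (T ×ˢ T).filter (fun p => p.1 * p.2 = i),
        x (p.1 * p.2 : ℕ+) ^ (lam.parts.count (p.1 : ℕ) * z p.2 lam) := by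
        refine Finset.prod_congr rfl fun i hi => ?_
        rw [hdiv i hi]
        exact Finset.prod_congr rfl fun p hp => by rw [(Finset.mem_filter.1 hp).2]
    _ = ∏ p ∈ T ×ˢ T, x (p.1 * p.2 : ℕ+) ^ (lam.parts.count (p.1 : ℕ) * z p.2 lam) := by
        rw [Finset.prod_fiberwise_eq_prod_filter]
        refine Finset.prod_filter_of_ne fun p _ hp => ?_
        contrapose! hp
        rw [hx, one_pow]
        have hp' : L < p.1 * p.2 := by simpa [T] using hp
        exact_mod_cast hp'
    _ = _ := by
        rw [Finset.prod_product_right]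
        refine Finset.prod_congr rfl fun l _ => ?_
        rw [Multiset.prod_map_eq_prod_pow_count (T := T) (fun i hi => lam.parts_pos hi),
          ← Finset.prod_pow]
        · refine Finset.prod_congr rfl fun j _ => ?_
          rw [pow_mul, PNat.mul_coe, mul_comm (j : ℕ)]
        · intro j hj
          have hj' : L < j := by simpa [T] using hj
          refine hx _ ?_
          have := hj'.trans_le (hle (a := l))
          exact_mod_cast this

theorem integral_pow_poissonMeasure (r : ℝ≥0) (w : ℝ) :
    ∫ z, w ^ z ∂(poissonMeasure r) = Real.exp (r * (w - 1)) := by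
  rw [integral_poissonMeasure, mul_sub, mul_one, sub_eq_add_neg, Real.exp_add,
    Real.exp_eq_exp_ℝ, ← (NormedSpace.expSeries_div_hasSum_exp (r * w)).tsum_eq, ← tsum_mul_right]
  refine tsum_congr fun n => ?_
  rw [smul_eq_mul, mul_pow]
  ring

/-- The joint probability generating function of the limit variables. -/
theorem integral_prod_pow_cycleSum {k : ℕ} (Γ : Subgroup (Equiv.Perm (Fin k)))
    {Ω : Type*} [MeasurableSpace Ω] (P : Measure Ω) [IsProbabilityMeasure P]
    (Z : ℕ+ → k.Partition → Ω → ℕ)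
    (hZ_law : ∀ (l : ℕ+) (lam : k.Partition),
      HasLaw (Z l lam) (poissonMeasure (cycleTypeProb Γ lam / (l : ℝ≥0))) P)
    (hZ_indep : iIndepFun (fun q : ℕ+ × k.Partition => Z q.1 q.2) P)
    {x : ℕ → ℝ} {L : ℕ+} (hx : ∀ i : ℕ, L < i → x i = 1) :
    ∫ ω, ∏ i ∈ Finset.Icc 1 L, x i ^ cycleSum (fun l lam => Z l lam ω) i ∂P =
      Real.exp (∑ l ∈ Finset.Icc 1 (L : ℕ), (blockWeight Γ x l - 1) / l) := by
  set T := Finset.Icc 1 L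
  let w (q : T × k.Partition) : ℝ := (q.2.parts.map fun j => x (q.1 * j)).prod
  have hind : iIndepFun (fun q : T × k.Partition => Z q.1 q.2) P :=
    hZ_indep.precomp (g := Prod.map Subtype.val id)
      (Subtype.val_injective.prodMap Function.injective_id)
  have hprod (ω : Ω) : ∏ i ∈ T, x i ^ cycleSum (fun l lam => Z l lam ω) i =
      ∏ q : T × k.Partition, w q ^ Z q.1 q.2 ω := by
    rw [prod_pow_cycleSum _ hx, ← Finset.prod_coe_sort, Fintype.prod_prod_type]
  simp_rw [hprod]
  rw [hind.integral_fun_prod_comp (f := fun q z => w q ^ z) (fun q => (hZ_law _ _).aemeasurable)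
    fun q => (measurable_of_countable _).aestronglyMeasurable]
  have hfactor (q : T × k.Partition) : ∫ ω, w q ^ Z q.1 q.2 ω ∂P =
      Real.exp (cycleTypeProb Γ q.2 / ((q.1 : ℕ+) : ℕ) * (w q - 1)) := by
    refine ((hZ_law q.1 q.2).integral_comp (f := fun z => w q ^ z)
      (measurable_of_countable _).aestronglyMeasurable).trans ?_
    rw [integral_pow_poissonMeasure]
    simp
  simp_rw [hfactor]
  rw [← Real.exp_sum, Fintype.sum_prod_type,
    Finset.sum_coe_sort T fun l => ∑ lam : k.Partition, (cycleTypeProb Γ lam : ℝ) / (l : ℕ) *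
      ((lam.parts.map fun j => x (l * j)).prod - 1)]
  congr 1
  have hT : Finset.Icc 1 (L : ℕ) = T.map ⟨_, PNat.coe_injective⟩ :=
    (PNat.map_subtype_embedding_Icc 1 L).symm
  rw [hT, Finset.sum_map]
  refine Finset.sum_congr rfl fun l _ => ?_
  rw [blockWeight, ← sum_cycleTypeProb Γ, ← Finset.sum_sub_distrib, Finset.sum_div]
  refine Finset.sum_congr rfl fun lam _ => ?_
  simp only [Function.Embedding.coeFn_mk]
  rw [sum_cycleTypeProb]
  ring

theorem theorem3p2 {k : ℕ} (Γ : Subgroup (Equiv.Perm (Fin k)))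
    {Ω : Type*} [MeasurableSpace Ω] (P : Measure Ω) [IsProbabilityMeasure P]
    (Z : ℕ+ → k.Partition → Ω → ℕ)
    (hZ_law : ∀ (l : ℕ+) (lam : k.Partition),
      HasLaw (Z l lam) (poissonMeasure (cycleTypeProb Γ lam / (l : ℝ≥0))) P)
    (hZ_indep : iIndepFun (fun q : ℕ+ × k.Partition => Z q.1 q.2) P) :
    TendstoInDistribution
      (fun (n : ℕ) (σ : WreathProduct Γ n) (i : ℕ+) => cycleCount (WreathProduct.toPerm σ) i)
      atTop
      (fun (ω : Ω) (i : ℕ+) => cycleSum (fun l lam => Z l lam ω) i)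
      (fun n => uniformOn (Set.univ : Set (WreathProduct Γ n)))
      P := by
  have hZ (l : ℕ+) (lam : k.Partition) : AEMeasurable (Z l lam) P := (hZ_law l lam).aemeasurable
  have hX (n : ℕ) : AEMeasurable (fun (σ : WreathProduct Γ n) (i : ℕ+) =>
      cycleCount (WreathProduct.toPerm σ) i) (uniformOn Set.univ) := .of_discrete
  have hA : AEMeasurable (fun (ω : Ω) (i : ℕ+) => cycleSum (fun l lam => Z l lam ω) i) P := by
    refine aemeasurable_pi_lambda _ fun i => ?_
    unfold cycleSum
    fun_prop
  refine ⟨hX, hA, tendsto_of_forall_tendsto_pgf fun m => ?_⟩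
  obtain ⟨L, hL⟩ : ∃ L : ℕ+, ∀ i ∈ m.support, i ≤ L := m.support.exists_le
  let x (i : ℕ) : ℝ := (1 / 2) ^ m i.toPNat'
  have hxcoe (i : ℕ+) : x i = (1 / 2) ^ m i := by simp [x]
  have hx1 (i : ℕ+) (hi : i ∉ m.support) : x i = 1 := by
    rw [hxcoe, Finsupp.notMem_support_iff.1 hi, pow_zero]
  have hxL (i : ℕ) (hi : L < i) : x i = 1 :=
    hx1 ⟨i, L.pos.trans hi⟩ fun h => (hL _ h).not_gt hi
  have hmeas : Measurable fun a : ℕ+ → ℕ => ∏ i ∈ m.support, ((1 / 2 : ℝ) ^ m i) ^ a i := by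
    fun_prop
  have hfin (n : ℕ) : ∫ σ : WreathProduct Γ n, ∏ i ∈ m.support,
      ((1 / 2 : ℝ) ^ m i) ^ cycleCount (WreathProduct.toPerm σ) i ∂(uniformOn Set.univ) =
      cycleIndex (blockWeight Γ x) n := by
    rw [← integral_prod_partition_toPerm]
    congr with σ
    rw [Multiset.prod_map_eq_prod_pow_count (fun i hi => Nat.Partition.parts_pos _ hi) hx1]
    simp_rw [hxcoe]
    rfl
  have hlim : ∫ ω, ∏ i ∈ m.support,
      ((1 / 2 : ℝ) ^ m i) ^ cycleSum (fun l lam => Z l lam ω) i ∂P =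
      Real.exp (∑ l ∈ Finset.Icc 1 (L : ℕ), (blockWeight Γ x l - 1) / l) := by
    rw [← integral_prod_pow_cycleSum Γ P Z hZ_law hZ_indep hxL]
    congr with ω
    simp_rw [← hxcoe]
    refine Finset.prod_subset (fun i hi => Finset.mem_Icc.2 ⟨one_le, hL i hi⟩)
      fun i _ hi => ?_
    rw [hx1 i hi, one_pow]
  simp only [ProbabilityMeasure.coe_mk]
  simp_rw [integral_map (hX _) hmeas.aestronglyMeasurable,
    integral_map hA hmeas.aestronglyMeasurable, hfin, hlim]
  refine tendsto_exp_of_recursion (cycleIndex_zero _) (natCast_mul_cycleIndex _) fun l hl => ?_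
  rw [blockWeight, ← sum_cycleTypeProb Γ]
  refine Finset.sum_congr rfl fun lam _ => ?_
  rw [Multiset.prod_eq_one, mul_one]
  intro y hy
  obtain ⟨j, hj, rfl⟩ := Multiset.mem_map.1 hy
  exact hxL _ (hl.trans_le (Nat.le_mul_of_pos_right _ (lam.parts_pos hj)))
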